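/- **Conventions.** A graph is $g=(V,E,\ell_V,\ell_E)$ with $V$ a finite set, $E\subseteq[V]^2$ a set of 2-element subsets of $V$, and label functions $\ell_V:V\to\Sigma_V$, $\ell_E:E\to\Sigma_E$; isomorphic graphs (with labels preserved) are identified. Let $\varepsilon_V\notin\Sigma_V$, $\varepsilon_E\notin\Sigma_E$ be extra "empty" labels. For $m\ge|V|$, the graph $m$-completion $\kappa_m(g)$ is the complete graph on $m$ vertices obtained from $g$ by adding $m-|V|$ new vertices, labelled $\varepsilon_V$, and all missing edges, labelled $\varepsilon_E$. Given edit cost functions $c_V:(\Sigma_V\cup\{\varepsilon_V\})^2\to[0,\infty)$ and $c_E:(\Sigma_E\cup\{\varepsilon_E\})^2\to[0,\infty)$, the graph edit distance of $g_1,g_2$ is $$d_{\mathrm{GED}}(g_1,g_2)=\min_f\Big(\sum_{v\in V_1'}c_V\big(\ell_{V_1}'(v),\ell_{V_2}'(f(v))\big)+\sum_{e\in E_1'}c_E\big(\ell_{E_1}'(e),\ell_{E_2}'(f(e))\big)\Big),$$ where $(V_i',E_i',\ell_{V_i}',\ell_{E_i}')=\kappa_{|V_1|+|V_2|}(g_i)$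 and $f$ runs over the bijections $V_1'\to V_2'$. An MCS model is a triple $(X,\preccurlyeq,s)$ with $\preccurlyeq$ a partial order on the set $X$ and $s:X\to[0,\infty)$ such that (S1) $x_1\preccurlyeq x_2$ implies $s(x_1)\le s(x_2)$; (S2) $x_1\preccurlyeq x_2$ and $s(x_1)=s(x_2)$ imply $x_1=x_2$; (A1) for all $x_1,x_2$ the set $cs(\{x_1,x_2\})=\{x: x\preccurlyeq x_1,\ x\preccurlyeq x_2\}$ is non-empty and $s$ attains a maximum on it, denoted $s'(\{x_1,x_2\})$; (A2) if $x_1,x_2\preccurlyeq x$ then some $x_{12}\in cs(\{x_1,x_2\})$ satisfies $s(x)\ge s(x_1)+s(x_2)-s(x_{12})$. **Theorem.** Let $\Sigma_V,\Sigma_E$ be finite, let $n\ge 0$, let $G_n$ be the set of graphs with at most $n$ vertices and labels in $\Sigma_V,\Sigma_E$, and let $c_V$ and $c_E$ be metrics on $\Sigma_V\cup\{\varepsilon_V\}$ and $\Sigma_E\cup\{\varepsilon_E\}$. Then there are an MCS model $(X,\preccurlyeq_X,s_X)$ and an injective map $\theta:G_n\to X$ such that for all $g_1,g_2\in G_n$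 $$d_{\mathrm{GED}}(g_1,g_2)=s_X(\theta(g_1))+s_X(\theta(g_2))-2\,s_X'(\{\theta(g_1),\theta(g_2)\}).$$ Moreover, these can be chosen as follows: there are MCS models $(\Sigma_V',\preccurlyeq_V,s_V)$ and $(\Sigma_E',\preccurlyeq_E,s_E)$ with strictly positive size functions, on sets $\Sigma_V'\supseteq\Sigma_V\cup\{\varepsilon_V\}$ and $\Sigma_E'\supseteq\Sigma_E\cup\{\varepsilon_E\}$, such that $X$ is the set of complete graphs with exactly $2n$ vertices and labels in $\Sigma_V',\Sigma_E'$; $g\preccurlyeq_X h$ means that there is an injective graph homomorphism $\varphi:g\to h$ with the label of each vertex $v$ and edge $e$ of $g$ being $\preccurlyeq_V$, respectively $\preccurlyeq_E$, the label of $\varphi(v)$, respectively $\varphi(e)$; $s_X(g)$ is the sum of the sizes of all vertex and edge labels of $g$; and $\theta=\kappa_{2n}$ is the graph $2n$-completion. -/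

import Mathlib

/-! ## Maximum Common Subelement (MCS) models -/

namespace GEDMCS

universe u v

/-- `d` is a metric on `X`. -/
structure IsMetric {X : Type u} (d : X → X → ℝ) : Prop where
  nonneg : ∀ x y, 0 ≤ d x y
  self : ∀ x, d x x = 0
  symm : ∀ x y, d x y = d y x
  triangle : ∀ x y z, d x z ≤ d x y + d y z
  eq_of_zero : ∀ x y, d x y = 0 → x = y

/-- The set `cs(A)` of common subelements of the elements of `A`. -/
def commonSub {X : Type u} (le : X → X → Prop) (A : Set X) : Set X :=
  {x | ∀ y ∈ A, le x y}

/-- `le` is a partial order on `X`. -/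
structure IsPartOrd {X : Type u} (le : X → X → Prop) : Prop where
  refl : ∀ x, le x x
  trans : ∀ x y z, le x y → le y z → le x z
  antisymm : ∀ x y, le x y → le y x → x = y

/-- `s` is a size function on `(X, le)`. -/
structure IsSizeFunction {X : Type u} (le : X → X → Prop) (s : X → ℝ) : Prop where
  nonneg : ∀ x, 0 ≤ s x
  mono : ∀ x y, le x y → s x ≤ s y
  eq_of_size_eq : ∀ x y, le x y → s x = s y → x = y

/-- The triple `(X, le, s)` is a Maximum Common Subelement model. -/
structure IsMCSModel {X : Type u} (le : X → X → Prop) (s : X → ℝ) : Prop where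
  partOrd : IsPartOrd le
  size : IsSizeFunction le s
  /-- Two elements have a common subelement, and one of maximum size. -/
  exists_max : ∀ x₁ x₂, (commonSub le {x₁, x₂}).Nonempty ∧
    ∃ m, IsGreatest (s '' commonSub le {x₁, x₂}) m
  /-- The size of a common superelement bounds the size of the "union". -/
  diamond : ∀ x₁ x₂ x, le x₁ x → le x₂ x →
    ∃ x₁₂ ∈ commonSub le {x₁, x₂}, s x ≥ s x₁ + s x₂ - s x₁₂

/-- The maximum common subelement size `s'(A) = max {s x | x ∈ cs(A)}`. In an MCS model the
maximum exists whenever `A` is a pair, and the supremum is then that maximum. -/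
noncomputable def mcsSize {X : Type u} (le : X → X → Prop) (s : X → ℝ) (A : Set X) : ℝ :=
  sSup (s '' commonSub le A)

theorem IsMCSModel.isGreatest_mcsSize {X : Type u} {le : X → X → Prop} {s : X → ℝ}
    (h : IsMCSModel le s) (x₁ x₂ : X) :
    IsGreatest (s '' commonSub le {x₁, x₂}) (mcsSize le s {x₁, x₂}) := by
  obtain ⟨m, hm⟩ := (h.exists_max x₁ x₂).2
  rw [mcsSize, hm.csSup_eq]
  exact hm

/-! ## Labelled graphs -/

/-- Finite undirected simple graphs with vertex labels in `LV` and edge labels in `LE`. -/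
structure LGraph (LV : Type u) (LE : Type v) where
  V : Type
  fintypeV : Fintype V
  graph : SimpleGraph V
  vlabel : V → LV
  elabel : graph.edgeSet → LE

namespace LGraph

variable {LV : Type u} {LE : Type v}

instance (g : LGraph LV LE) : Fintype g.V := g.fintypeV

/-- The number of vertices. -/
def order (g : LGraph LV LE) : ℕ := Fintype.card g.V

/-- Two labelled graphs are isomorphic: a graph isomorphism preserves all labels. -/
def Isomorphic (g h : LGraph LV LE) : Prop :=
  ∃ φ : g.graph ≃g h.graph,
    (∀ w, g.vlabel w = h.vlabel (φ w)) ∧ (∀ e, g.elabel e = h.elabel (φ.mapEdgeSet e))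

/-- Replace all labels by their images under `i` and `j`. -/
def relabel {LV' : Type*} {LE' : Type*} (i : LV → LV') (j : LE → LE')
    (g : LGraph LV LE) : LGraph LV' LE' where
  V := g.V
  fintypeV := g.fintypeV
  graph := g.graph
  vlabel w := i (g.vlabel w)
  elabel e := j (g.elabel e)

open Classical in
/-- The graph `m`-completion (for `g.order ≤ m`): `m - g.order` new vertices are added, and
all pairs of distinct vertices become edges. The labels of `g` are kept, and new vertices and
new edges get the empty label, which is `none`. -/
noncomputable def completion (m : ℕ) (g : LGraph LV LE) : LGraph (Option LV) (Option LE) where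
  V := g.V ⊕ Fin (m - g.order)
  fintypeV := inferInstance
  graph := ⊤
  vlabel := Sum.elim (fun w => some (g.vlabel w)) (fun _ => none)
  elabel e :=
    if h : ∃ e₀ : g.graph.edgeSet,
        Sym2.map (Sum.inl : g.V → g.V ⊕ Fin (m - g.order)) e₀.1 = e.1
    then some (g.elabel h.choose) else none

/-- `h` is extended subgraph isomorphic to `g` with respect to relations `rV`, `rE` on the
labels: `g` is isomorphic to some `g'` whose vertex and edge sets are contained in those of `h`
(the image of the copy `φ`), each label of `g'` being below the corresponding label of `h`. -/
def ExtSub (rV : LV → LV → Prop) (rE : LE → LE → Prop) (g h : LGraph LV LE) : Prop :=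
  ∃ φ : SimpleGraph.Copy g.graph h.graph,
    (∀ w, rV (g.vlabel w) (h.vlabel (φ w))) ∧
    (∀ e, rE (g.elabel e) (h.elabel (φ.toHom.mapEdgeSet e)))

open Classical in
/-- The size of a graph: the sum of the sizes of its vertex and edge labels. -/
noncomputable def totalSize (sV : LV → ℝ) (sE : LE → ℝ) (g : LGraph LV LE) : ℝ :=
  ∑ w : g.V, sV (g.vlabel w) + ∑ e : g.graph.edgeSet, sE (g.elabel e)

open Classical in
/-- The cost of a bijection between the vertices of the `m`-completions of two graphs. Both
completions are complete graphs, so such a bijection also maps edges to edges. -/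
noncomputable def bijCost (cV : Option LV → Option LV → ℝ) (cE : Option LE → Option LE → ℝ)
    (m : ℕ) (g₁ g₂ : LGraph LV LE) (f : (g₁.completion m).V ≃ (g₂.completion m).V) : ℝ :=
  ∑ w : (g₁.completion m).V,
      cV ((g₁.completion m).vlabel w) ((g₂.completion m).vlabel (f w)) +
    ∑ e : (⊤ : SimpleGraph (g₁.completion m).V).edgeSet,
      cE ((g₁.completion m).elabel e)
        ((g₂.completion m).elabel ((SimpleGraph.Iso.completeGraph f).mapEdgeSet e))

/-- The graph edit distance: the minimum (over a finite nonempty set) of the costs of the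
bijections between the vertices of the completions of the graphs to `|V₁| + |V₂|` vertices. -/
noncomputable def ged (cV : Option LV → Option LV → ℝ) (cE : Option LE → Option LE → ℝ)
    (g₁ g₂ : LGraph LV LE) : ℝ :=
  ⨅ f : (g₁.completion (g₁.order + g₂.order)).V ≃ (g₂.completion (g₁.order + g₂.order)).V,
    bijCost cV cE (g₁.order + g₂.order) g₁ g₂ f

theorem card_completion {m : ℕ} (g : LGraph LV LE) (h : g.order ≤ m) :
    (g.completion m).order = m := by
  have key : (g.completion m).order = Fintype.card (g.V ⊕ Fin (m - g.order)) :=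
    Fintype.card_congr (Equiv.refl _)
  rw [key, Fintype.card_sum, Fintype.card_fin]
  exact Nat.add_sub_cancel' h

/-- The minimum that defines the graph edit distance is attained. -/
theorem isLeast_ged (cV : Option LV → Option LV → ℝ) (cE : Option LE → Option LE → ℝ)
    (g₁ g₂ : LGraph LV LE) :
    IsLeast (Set.range (bijCost cV cE (g₁.order + g₂.order) g₁ g₂)) (ged cV cE g₁ g₂) := by
  classical
  have hc : Fintype.card (g₁.completion (g₁.order + g₂.order)).V =
      Fintype.card (g₂.completion (g₁.order + g₂.order)).V :=
    (card_completion g₁ (Nat.le_add_right _ _)).trans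
      (card_completion g₂ (Nat.le_add_left _ _)).symm
  have : Nonempty ((g₁.completion (g₁.order + g₂.order)).V ≃
      (g₂.completion (g₁.order + g₂.order)).V) := ⟨Fintype.equivOfCardEq hc⟩
  refine ⟨exists_eq_ciInf_of_finite, ?_⟩
  rintro _ ⟨f, rfl⟩
  exact ciInf_le (Set.finite_range _).bddBelow f

theorem Isomorphic.equivalence :
    Equivalence (Isomorphic : LGraph LV LE → LGraph LV LE → Prop) where
  refl g := ⟨SimpleGraph.Iso.refl, fun _ => rfl, fun e => by
    congr 1
    exact Subtype.ext (by simp [SimpleGraph.Iso.mapEdgeSet, SimpleGraph.Hom.mapEdgeSet])⟩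
  symm := by
    rintro g h ⟨φ, hv, he⟩
    refine ⟨φ.symm, fun w => ?_, fun e => ?_⟩
    · rw [hv, RelIso.apply_symm_apply]
    · rw [he]
      exact congrArg _ (φ.mapEdgeSet.apply_symm_apply e).symm
  trans := by
    rintro g h k ⟨φ, hv, he⟩ ⟨ψ, kv, ke⟩
    refine ⟨φ.trans ψ, fun w => (hv w).trans (kv _), fun e => ?_⟩
    rw [he, ke]
    congr 1
    refine Subtype.ext ?_
    obtain ⟨e, h⟩ := e
    induction e with
    | _ a b => rfl

/-- Isomorphic graphs are identified. -/
instance setoid (LV : Type u) (LE : Type v) : Setoid (LGraph LV LE) where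
  r := Isomorphic
  iseqv := Isomorphic.equivalence

end LGraph

/-- Labelled graphs up to isomorphism. -/
abbrev GraphClass (LV : Type u) (LE : Type v) : Type (max 1 u v) :=
  Quotient (LGraph.setoid LV LE)

/-- The set `G_n` of graphs with at most `n` vertices, up to isomorphism. -/
def smallGraphs (LV : Type u) (LE : Type v) (n : ℕ) : Set (GraphClass LV LE) :=
  {q | ∃ g : LGraph LV LE, ⟦g⟧ = q ∧ g.order ≤ n}

/-- The set `K_m` of complete graphs with exactly `m` vertices, up to isomorphism. -/
def completeGraphs (LV : Type u) (LE : Type v) (m : ℕ) : Set (GraphClass LV LE) :=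
  {q | ∃ g : LGraph LV LE, ⟦g⟧ = q ∧ g.graph = ⊤ ∧ g.order = m}

end GEDMCS

open GEDMCS
universe u v

/-!
The metrics `cV` and `cE` are realised by label models, and these models are then lifted to
complete graphs.

A finite metric space embeds isometrically into a normed space `E` (`ℓ^∞` of its points, by the
Kuratowski embedding). The formal balls of `E`, ordered by reverse inclusion and with a constant
minus the radius as size, form an MCS model as soon as a bottom element is added: the centres
of the common subelements required in a model are points of segments of `E`
(`FormalBall.exists_common`). Points become balls of one common size, and the smallest ball around
two of them has half of their distance as radius, so the distance is the sum of the two sizes minus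
twice the maximum common subelement size (`exists_isMCSModel_of_isMetric`). The bottom element cuts
off large balls and thereby keeps all sizes positive.

Between complete graphs of the same order, an injective homomorphism is a bijection of the vertices.
Consequently the axioms of an MCS model hold for complete graphs because they hold label by label
(`completeGraphs.isMCSModel`), and the maximum common subelement size of two graphs is the maximum,
over all bijections, of the sum of those of the matched labels
(`completeGraphs.isGreatest_size_commonSub`). The cost of a bijection equals the sum of the two
total sizes minus twice that sum, so the cheapest bijection has the largest overlap
(`ged_eq_size_add_size_sub`).

It remains to compare the completions to `|V₁| + |V₂|` vertices, which define the graph edit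
distance, with those to `2 * n` vertices. A bijection of the larger completions matches enough new
vertices with each other for these to be removed, or added, at cost zero (`isLeast_complCost`).
-/

namespace GEDMCS

theorem mem_commonSub_pair {X : Type u} {le : X → X → Prop} {x a b : X} :
    x ∈ commonSub le {a, b} ↔ le x a ∧ le x b := by
  simp [commonSub]

/-! ### Metrics realised by label models -/

section FormalBall

variable (E : Type u)

/-- Formal balls of a metric space, with a bottom element `none` adjoined. The ball `(p, t)` is
recorded by its centre and its size `t`, which stands for a constant minus the radius; only
balls of size larger than `1` are kept. -/
abbrev FormalBall : Type u := Option (E × Set.Ioi (1 : ℝ))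

variable {E}

/-- The size of a formal ball; the bottom element has size `1`. -/
def FormalBall.size : FormalBall E → ℝ
  | none => 1
  | some x => x.2.1

theorem FormalBall.one_le_size (x : FormalBall E) : 1 ≤ x.size := by
  rcases x with _ | ⟨p, r, hr⟩
  · exact le_rfl
  · exact le_of_lt hr

variable [NormedAddCommGroup E]

/-- Reverse inclusion of formal balls: the ball `(p, s)` is below `(q, t)` if the distance of the
centres is at most the difference `t - s` of the radii. -/
def FormalBall.le : FormalBall E → FormalBall E → Prop
  | none, _ => True
  | some _, none => False
  | some x, some y => dist x.1 y.1 ≤ y.2.1 - x.2.1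

theorem FormalBall.isPartOrd : IsPartOrd (FormalBall.le (E := E)) where
  refl x := by
    rcases x with _ | x <;> simp [FormalBall.le]
  trans x y z hxy hyz := by
    rcases x with _ | x
    · trivial
    rcases y with _ | y
    · exact hxy.elim
    rcases z with _ | z
    · exact hyz.elim
    simp only [FormalBall.le] at *
    linarith [dist_triangle x.1 y.1 z.1]
  antisymm x y hxy hyx := by
    rcases x with _ | ⟨p, r, hr⟩ <;> rcases y with _ | ⟨q, t, ht⟩
    · rfl
    · exact hyx.elim
    · exact hxy.elim
    simp only [FormalBall.le] at *
    rw [dist_comm] at hyx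
    obtain rfl : p = q := dist_le_zero.mp (by linarith)
    obtain rfl : r = t := by rw [dist_self] at *; linarith
    rfl

theorem FormalBall.isSizeFunction :
    IsSizeFunction (FormalBall.le (E := E)) FormalBall.size where
  nonneg x := zero_le_one.trans x.one_le_size
  mono x y h := by
    rcases x with _ | x
    · exact y.one_le_size
    rcases y with _ | y
    · exact h.elim
    simp only [FormalBall.le, FormalBall.size] at *
    linarith [dist_nonneg (x := x.1) (y := y.1)]
  eq_of_size_eq x y h hs := by
    rcases x with _ | ⟨p, r, hr⟩ <;> rcases y with _ | ⟨q, t, ht⟩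
    · rfl
    · exact absurd hs (ne_of_lt ht)
    · exact h.elim
    simp only [FormalBall.le, FormalBall.size] at *
    subst hs
    obtain rfl : p = q := dist_le_zero.mp (by linarith)
    rfl

variable [NormedSpace ℝ E]

/-- Two formal balls have a common subelement of any size `v` permitted by the sizes and by the
distance of the centres: the centre is found on the segment between the two centres. -/
theorem FormalBall.exists_common {p q : E} {r t : Set.Ioi (1 : ℝ)} {v : ℝ} (hv : 1 < v)
    (hr : v ≤ r) (ht : v ≤ t) (h : 2 * v ≤ r + t - dist p q) :
    ∃ z ∈ commonSub FormalBall.le {(some (p, r) : FormalBall E), some (q, t)},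
      z.size = v := by
  obtain ⟨c, hc₁, hc₂⟩ := exists_dist_le_le (E := E) (x := p) (z := q)
    (δ := r - v) (ε := t - v) (by linarith) (by linarith) (by linarith)
  refine ⟨some (c, ⟨v, hv⟩), mem_commonSub_pair.mpr ⟨?_, hc₂⟩, rfl⟩
  rwa [FormalBall.le, dist_comm]

/-- The maximum common subelement size of two formal balls. The last term of the minimum comes
from the triangle inequality, and the bottom element accounts for the maximum with `1`. -/
theorem FormalBall.isGreatest_size_commonSub (p q : E) (r t : Set.Ioi (1 : ℝ)) :
    IsGreatest (FormalBall.size '' commonSub FormalBall.le {(some (p, r) : FormalBall E),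
      some (q, t)}) (max 1 (min (min r.1 t.1) ((r + t - dist p q) / 2))) := by
  constructor
  · rcases lt_or_ge 1 (min (min r.1 t.1) ((r + t - dist p q) / 2)) with h | h
    · rw [max_eq_right h.le]
      obtain ⟨z, hz, hs⟩ := FormalBall.exists_common (p := p) (q := q) (r := r) (t := t) h
        ((min_le_left _ _).trans (min_le_left _ _)) ((min_le_left _ _).trans (min_le_right _ _))
        (by linarith [min_le_right (min r.1 t.1) ((r + t - dist p q) / 2)])
      exact ⟨z, hz, hs⟩
    · rw [max_eq_left h]
      exact ⟨none, mem_commonSub_pair.mpr ⟨trivial, trivial⟩, rfl⟩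
  · rintro _ ⟨z, hz, rfl⟩
    obtain ⟨h₁, h₂⟩ := mem_commonSub_pair.mp hz
    rcases z with _ | ⟨c, s⟩
    · exact le_max_left _ _
    · simp only [FormalBall.le, FormalBall.size] at *
      have := dist_triangle_left p q c
      have := dist_nonneg (x := c) (y := p)
      have := dist_nonneg (x := c) (y := q)
      exact le_max_of_le_right (le_min (le_min (by linarith) (by linarith)) (by linarith))

theorem FormalBall.isMCSModel : IsMCSModel (FormalBall.le (E := E)) FormalBall.size where
  partOrd := FormalBall.isPartOrd
  size := FormalBall.isSizeFunction
  exists_max x₁ x₂ := by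
    refine ⟨⟨none, mem_commonSub_pair.mpr ⟨trivial, trivial⟩⟩, ?_⟩
    rcases x₁ with _ | ⟨p, r⟩
    · refine ⟨1, ⟨none, mem_commonSub_pair.mpr ⟨trivial, trivial⟩, rfl⟩, ?_⟩
      rintro _ ⟨z, hz, rfl⟩
      exact FormalBall.isSizeFunction.mono _ _ (mem_commonSub_pair.mp hz).1
    rcases x₂ with _ | ⟨q, t⟩
    · refine ⟨1, ⟨none, mem_commonSub_pair.mpr ⟨trivial, trivial⟩, rfl⟩, ?_⟩
      rintro _ ⟨z, hz, rfl⟩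
      exact FormalBall.isSizeFunction.mono _ _ (mem_commonSub_pair.mp hz).2
    exact ⟨_, FormalBall.isGreatest_size_commonSub p q r t⟩
  diamond x₁ x₂ x h₁ h₂ := by
    rcases x₁ with _ | ⟨p, r⟩
    · refine ⟨none, mem_commonSub_pair.mpr ⟨trivial, trivial⟩, ?_⟩
      linarith [FormalBall.isSizeFunction.mono _ _ h₂]
    rcases x₂ with _ | ⟨q, t⟩
    · refine ⟨none, mem_commonSub_pair.mpr ⟨trivial, trivial⟩, ?_⟩
      linarith [FormalBall.isSizeFunction.mono _ _ h₁]
    rcases x with _ | ⟨c, s⟩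
    · exact h₁.elim
    simp only [FormalBall.le] at h₁ h₂
    -- `r + t - s` is the size required of the common subelement; it may fall below the cut-off
    rcases lt_or_ge 1 (r.1 + t.1 - s.1) with hv | hv
    · have := dist_triangle_right p q c
      have := dist_nonneg (x := p) (y := c)
      have := dist_nonneg (x := q) (y := c)
      obtain ⟨z, hz, hs⟩ := FormalBall.exists_common (p := p) (q := q) (r := r) (t := t) hv
        (by linarith) (by linarith) (by linarith)
      refine ⟨z, hz, ?_⟩
      rw [hs]
      simp only [FormalBall.size]
      linarith
    · refine ⟨none, mem_commonSub_pair.mpr ⟨trivial, trivial⟩, ?_⟩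
      simp only [FormalBall.size]
      linarith

end FormalBall

/-- Every finite metric space embeds into an MCS model with positive sizes in which the metric is
`s x + s y - 2 s' {x, y}`: take the formal balls of one large size around the points of the
Kuratowski embedding into a space of bounded functions. -/
theorem exists_isMCSModel_of_isMetric {S : Type u} [Finite S] {d : S → S → ℝ}
    (hd : IsMetric d) :
    ∃ (L : Type u) (ι : S → L) (le : L → L → Prop) (s : L → ℝ), Function.Injective ι ∧
      IsMCSModel le s ∧ (∀ a, 0 < s a) ∧
      ∀ a b, d a b = s (ι a) + s (ι b) - 2 * mcsSize le s {ι a, ι b} := by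
  have := Fintype.ofFinite S
  obtain ⟨C, hC⟩ := (Set.finite_range (fun z : S × S => d z.1 z.2)).bddAbove
  have hC : ∀ a b, d a b ≤ C := fun a b => hC ⟨(a, b), rfl⟩
  have hdist : ∀ a b, dist (fun c => d a c) (fun c => d b c) = d a b := by
    intro a b
    apply le_antisymm
    · refine (dist_pi_le_iff (hd.nonneg a b)).mpr fun c => ?_
      rw [Real.dist_eq, abs_le]
      constructor
      · linarith [hd.triangle b a c, hd.symm a b]
      · linarith [hd.triangle a b c]
    · have h := dist_le_pi_dist (fun c => d a c) (fun c => d b c) b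
      rwa [Real.dist_eq, hd.self, sub_zero, abs_of_nonneg (hd.nonneg a b)] at h
  -- the size `2 + |C|` keeps all the midpoints of the embedded points above the cut-off
  have hM : (1 : ℝ) < 2 + |C| := by linarith [abs_nonneg C]
  refine ⟨FormalBall (S → ℝ), fun a => some (fun c => d a c, ⟨2 + |C|, hM⟩), FormalBall.le,
    FormalBall.size, ?_, FormalBall.isMCSModel, fun a => zero_lt_one.trans_le a.one_le_size, ?_⟩
  · intro a b h
    have h : (fun c => d a c) = fun c => d b c := congrArg Prod.fst (Option.some.inj h)
    refine hd.eq_of_zero a b ?_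
    rw [← hdist, h, dist_self]
  · intro a b
    rw [mcsSize, (FormalBall.isGreatest_size_commonSub _ _ _ _).csSup_eq, hdist]
    simp only [FormalBall.size, min_self]
    have := hd.nonneg a b
    have := hC a b
    have := le_abs_self C
    have := abs_nonneg C
    rw [min_eq_right (by linarith), max_eq_right (by linarith)]
    ring

/-! ### The extended subgraph relation -/

namespace LGraph

variable {LV : Type u} {LE : Type v} {rV : LV → LV → Prop} {rE : LE → LE → Prop}

theorem ExtSub.trans (hV : ∀ x y z, rV x y → rV y z → rV x z)
    (hE : ∀ x y z, rE x y → rE y z → rE x z) {g h k : LGraph LV LE}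
    (h₁ : g.ExtSub rV rE h) (h₂ : h.ExtSub rV rE k) : g.ExtSub rV rE k := by
  obtain ⟨φ, φv, φe⟩ := h₁
  obtain ⟨ψ, ψv, ψe⟩ := h₂
  refine ⟨ψ.comp φ, fun w => hV _ _ _ (φv w) (ψv _), fun e => ?_⟩
  have key : (ψ.comp φ).toHom.mapEdgeSet e =
      ψ.toHom.mapEdgeSet (φ.toHom.mapEdgeSet e) := by
    refine Subtype.ext ?_
    obtain ⟨e, he⟩ := e
    induction e with
    | _ a b => rfl
  rw [key]
  exact hE _ _ _ (φe e) (ψe _)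

theorem Isomorphic.extSub (hV : ∀ x, rV x x) (hE : ∀ x, rE x x) {g h : LGraph LV LE}
    (i : g.Isomorphic h) : g.ExtSub rV rE h := by
  obtain ⟨φ, φv, φe⟩ := i
  refine ⟨φ.toCopy, fun w => ?_, fun e => ?_⟩
  · rw [φv]
    exact hV _
  · rw [φe]
    exact hE _

theorem Isomorphic.symm {g h : LGraph LV LE} (i : g.Isomorphic h) : h.Isomorphic g :=
  Isomorphic.equivalence.symm i

theorem Isomorphic.order_eq {g h : LGraph LV LE} (i : g.Isomorphic h) : g.order = h.order :=
  Fintype.card_congr i.choose.toEquiv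

theorem Isomorphic.totalSize_eq {g h : LGraph LV LE} (i : g.Isomorphic h) (sV : LV → ℝ)
    (sE : LE → ℝ) : g.totalSize sV sE = h.totalSize sV sE := by
  classical
  obtain ⟨φ, φv, φe⟩ := i
  unfold totalSize
  congr 1
  · exact Fintype.sum_equiv φ.toEquiv _ _ fun w => congrArg sV (φv w)
  · exact Fintype.sum_equiv φ.mapEdgeSet _ _ fun e => congrArg sE (φe e)

end LGraph

/-! ### Labellings of complete graphs -/

/-- The action of a bijection of vertices on the edges of the complete graphs. -/
def edgeEquiv {W W' : Type} (f : W ≃ W') :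
    (⊤ : SimpleGraph W).edgeSet ≃ (⊤ : SimpleGraph W').edgeSet :=
  (SimpleGraph.Iso.completeGraph f).mapEdgeSet

theorem coe_edgeEquiv {W W' : Type} (f : W ≃ W') (e : (⊤ : SimpleGraph W).edgeSet) :
    (edgeEquiv f e).1 = Sym2.map f e.1 := rfl

theorem edgeEquiv_trans_apply {W W' W'' : Type} (f : W ≃ W') (g : W' ≃ W'')
    (e : (⊤ : SimpleGraph W).edgeSet) :
    edgeEquiv (f.trans g) e = edgeEquiv g (edgeEquiv f e) :=
  Subtype.ext (by simp [coe_edgeEquiv, Sym2.map_map])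

theorem edgeEquiv_symm {W W' : Type} (f : W ≃ W') :
    edgeEquiv f.symm = (edgeEquiv f).symm := rfl

/-- A complete graph with prescribed labels. -/
def LGraph.ofLabels {LV : Type u} {LE : Type v} (W : Type) [Fintype W] (a : W → LV)
    (b : (⊤ : SimpleGraph W).edgeSet → LE) : LGraph LV LE :=
  ⟨W, inferInstance, ⊤, a, b⟩

/-- The class of a complete graph with prescribed labels. -/
def completeGraphs.mk {LV : Type u} {LE : Type v} {m : ℕ} (W : Type) [Fintype W]
    (hW : Fintype.card W = m) (a : W → LV) (b : (⊤ : SimpleGraph W).edgeSet → LE) :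
    completeGraphs LV LE m :=
  ⟨⟦LGraph.ofLabels W a b⟧, _, rfl, rfl, hW⟩

namespace completeGraphs

variable {LV : Type u} {LE : Type v} {m : ℕ}

theorem exists_eq_mk (x : completeGraphs LV LE m) :
    ∃ (W : Type) (_ : Fintype W) (hW : Fintype.card W = m) (a : W → LV)
      (b : (⊤ : SimpleGraph W).edgeSet → LE), x = mk W hW a b := by
  obtain ⟨_, ⟨W, _, G, a, b⟩, rfl, hG, hW⟩ := x
  change G = (⊤ : SimpleGraph W) at hG
  subst hG
  exact ⟨W, _, hW, a, b, rfl⟩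

/-- The extended subgraph relation on classes of complete graphs. -/
def le (leV : LV → LV → Prop) (leE : LE → LE → Prop) (x y : completeGraphs LV LE m) : Prop :=
  x.1.out.ExtSub leV leE y.1.out

/-- The total label size on classes of complete graphs. -/
noncomputable def size (sV : LV → ℝ) (sE : LE → ℝ) (x : completeGraphs LV LE m) : ℝ :=
  x.1.out.totalSize sV sE

theorem out_isomorphic {x : completeGraphs LV LE m} {g : LGraph LV LE} (hg : ⟦g⟧ = x.1) :
    x.1.out.Isomorphic g :=
  Quotient.exact ((Quotient.out_eq _).trans hg.symm)

theorem le_iff {leV : LV → LV → Prop} {leE : LE → LE → Prop} (hV : IsPartOrd leV)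
    (hE : IsPartOrd leE) {x y : completeGraphs LV LE m} {g h : LGraph LV LE}
    (hg : ⟦g⟧ = x.1) (hh : ⟦h⟧ = y.1) : le leV leE x y ↔ g.ExtSub leV leE h := by
  have hx := out_isomorphic hg
  have hy := out_isomorphic hh
  constructor
  · intro h₁
    exact ((hx.symm.extSub hV.refl hE.refl).trans hV.trans hE.trans h₁).trans hV.trans hE.trans
      (hy.extSub hV.refl hE.refl)
  · intro h₁
    exact ((hx.extSub hV.refl hE.refl).trans hV.trans hE.trans h₁).trans hV.trans hE.trans
      (hy.symm.extSub hV.refl hE.refl)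

theorem size_eq (sV : LV → ℝ) (sE : LE → ℝ) {x : completeGraphs LV LE m} {g : LGraph LV LE}
    (hg : ⟦g⟧ = x.1) : size sV sE x = g.totalSize sV sE :=
  (out_isomorphic hg).totalSize_eq sV sE

section mk

variable {W W' : Type} [Fintype W] [Fintype W'] {hW : Fintype.card W = m}
  {hW' : Fintype.card W' = m} {a : W → LV} {b : (⊤ : SimpleGraph W).edgeSet → LE}
  {a' : W' → LV} {b' : (⊤ : SimpleGraph W').edgeSet → LE}

theorem mk_eq_mk_iff : mk W hW a b = mk W' hW' a' b' ↔
    ∃ f : W ≃ W', (∀ w, a w = a' (f w)) ∧ ∀ e, b e = b' (edgeEquiv f e) := by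
  rw [Subtype.ext_iff]
  constructor
  · intro h
    obtain ⟨φ, hv, he⟩ := (Quotient.exact h : LGraph.Isomorphic _ _)
    exact ⟨φ.toEquiv, hv, he⟩
  · rintro ⟨f, hv, he⟩
    exact Quotient.sound (s := LGraph.setoid LV LE) ⟨SimpleGraph.Iso.completeGraph f, hv, he⟩

/-- An injective homomorphism between complete graphs of the same order is a bijection. -/
theorem mk_le_mk_iff {leV : LV → LV → Prop} {leE : LE → LE → Prop} (hV : IsPartOrd leV)
    (hE : IsPartOrd leE) : le leV leE (mk W hW a b) (mk W' hW' a' b') ↔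
    ∃ f : W ≃ W', (∀ w, leV (a w) (a' (f w))) ∧ ∀ e, leE (b e) (b' (edgeEquiv f e)) := by
  rw [le_iff hV hE (g := .ofLabels W a b) (h := .ofLabels W' a' b') rfl rfl]
  constructor
  · rintro ⟨φ, hv, he⟩
    have hb : Function.Bijective (fun w : W => (φ w : W')) :=
      (Fintype.bijective_iff_injective_and_card _).mpr ⟨φ.injective, hW.trans hW'.symm⟩
    refine ⟨Equiv.ofBijective _ hb, hv, fun e => ?_⟩
    exact he e
  · rintro ⟨f, hv, he⟩
    exact ⟨(SimpleGraph.Iso.completeGraph f).toCopy, hv, he⟩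

open Classical in
theorem size_mk (sV : LV → ℝ) (sE : LE → ℝ) :
    size sV sE (mk W hW a b) = ∑ w, sV (a w) + ∑ e, sE (b e) := by
  rw [size_eq sV sE (g := .ofLabels W a b) rfl]
  unfold LGraph.totalSize
  congr 1
  -- the two sums differ in the `Fintype` instance of the edge set only
  exact @Fintype.sum_equiv _ _ _ (_) (_) _ (Equiv.refl _) _ _ fun _ => rfl

end mk

/-! ### Complete graphs as an MCS model -/

variable {leV : LV → LV → Prop} {leE : LE → LE → Prop} {sV : LV → ℝ} {sE : LE → ℝ}

theorem isPartOrd_and_isSizeFunction (hV : IsMCSModel leV sV) (hE : IsMCSModel leE sE) :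
    IsPartOrd (le (m := m) leV leE) ∧ IsSizeFunction (le (m := m) leV leE) (size sV sE) := by
  classical
  have hs : IsSizeFunction (le (m := m) leV leE) (size sV sE) := by
    refine ⟨fun x => ?_, fun x y h => ?_, fun x y h hs => ?_⟩ <;>
      obtain ⟨W, _, hW, a, b, rfl⟩ := exists_eq_mk x
    · rw [size_mk]
      exact add_nonneg (Finset.sum_nonneg fun _ _ => hV.size.nonneg _)
        (Finset.sum_nonneg fun _ _ => hE.size.nonneg _)
    all_goals
      obtain ⟨W', _, hW', a', b', rfl⟩ := exists_eq_mk y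
      obtain ⟨f, hv, he⟩ := (mk_le_mk_iff hV.partOrd hE.partOrd).mp h
      have h₁ := Finset.sum_le_sum fun w (_ : w ∈ Finset.univ) => hV.size.mono _ _ (hv w)
      have h₂ := Finset.sum_le_sum fun e (_ : e ∈ Finset.univ) => hE.size.mono _ _ (he e)
      have e₁ := Equiv.sum_comp f fun w => sV (a' w)
      have e₂ := Equiv.sum_comp (edgeEquiv f) fun e => sE (b' e)
    · rw [size_mk, size_mk, ← e₁, ← e₂]
      exact add_le_add h₁ h₂
    · rw [size_mk, size_mk, ← e₁, ← e₂] at hs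
      have h₃ := (Finset.sum_eq_sum_iff_of_le fun w _ => hV.size.mono _ _ (hv w)).mp
        (by linarith)
      have h₄ := (Finset.sum_eq_sum_iff_of_le fun e _ => hE.size.mono _ _ (he e)).mp
        (by linarith)
      exact mk_eq_mk_iff.mpr
        ⟨f, fun w => hV.size.eq_of_size_eq _ _ (hv w) (h₃ w (Finset.mem_univ _)),
          fun e => hE.size.eq_of_size_eq _ _ (he e) (h₄ e (Finset.mem_univ _))⟩
  refine ⟨⟨fun x => ?_, fun x y z => ?_, fun x y hxy hyx => ?_⟩, hs⟩
  · exact (LGraph.Isomorphic.equivalence.refl _).extSub hV.partOrd.refl hE.partOrd.refl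
  · exact LGraph.ExtSub.trans hV.partOrd.trans hE.partOrd.trans
  · exact hs.eq_of_size_eq x y hxy ((hs.mono _ _ hxy).antisymm (hs.mono _ _ hyx))

section overlap

variable {W W' : Type} [Fintype W] [Fintype W']

open Classical in
/-- The total maximum common subelement size of the labels matched by a bijection `f`. -/
noncomputable def overlap (leV : LV → LV → Prop) (leE : LE → LE → Prop) (sV : LV → ℝ)
    (sE : LE → ℝ) (a : W → LV) (b : (⊤ : SimpleGraph W).edgeSet → LE) (a' : W' → LV)
    (b' : (⊤ : SimpleGraph W').edgeSet → LE) (f : W ≃ W') : ℝ :=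
  ∑ w, mcsSize leV sV {a w, a' (f w)} + ∑ e, mcsSize leE sE {b e, b' (edgeEquiv f e)}

/-- The common subelements of two complete graphs of maximum size arise by choosing a bijection
and, for each matched pair of labels, a maximum common subelement. -/
theorem isGreatest_size_commonSub (hV : IsMCSModel leV sV) (hE : IsMCSModel leE sE)
    {hW : Fintype.card W = m} {hW' : Fintype.card W' = m} {a : W → LV}
    {b : (⊤ : SimpleGraph W).edgeSet → LE} {a' : W' → LV}
    {b' : (⊤ : SimpleGraph W').edgeSet → LE} {M : ℝ}
    (hM : IsGreatest (Set.range (overlap leV leE sV sE a b a' b')) M) :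
    IsGreatest (size sV sE '' commonSub (le leV leE) {mk W hW a b, mk W' hW' a' b'}) M := by
  classical
  constructor
  · obtain ⟨f, rfl⟩ := hM.1
    choose α hα hαs using fun w => (hV.isGreatest_mcsSize (a w) (a' (f w))).1
    choose β hβ hβs using fun e => (hE.isGreatest_mcsSize (b e) (b' (edgeEquiv f e))).1
    refine ⟨mk W hW α β, mem_commonSub_pair.mpr ⟨?_, ?_⟩, ?_⟩
    · refine (mk_le_mk_iff hV.partOrd hE.partOrd).mpr
        ⟨Equiv.refl W, fun w => (mem_commonSub_pair.mp (hα w)).1, fun e => ?_⟩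
      have he : edgeEquiv (Equiv.refl W) e = e := Subtype.ext (by simp [coe_edgeEquiv])
      rw [he]
      exact (mem_commonSub_pair.mp (hβ e)).1
    · exact (mk_le_mk_iff hV.partOrd hE.partOrd).mpr
        ⟨f, fun w => (mem_commonSub_pair.mp (hα w)).2, fun e =>
          (mem_commonSub_pair.mp (hβ e)).2⟩
    · rw [size_mk, overlap]
      simp only [hαs, hβs]
  · rintro _ ⟨x, hx, rfl⟩
    obtain ⟨U, _, hU, α, β, rfl⟩ := exists_eq_mk x
    obtain ⟨h₁, h₂⟩ := mem_commonSub_pair.mp hx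
    obtain ⟨φ, φv, φe⟩ := (mk_le_mk_iff hV.partOrd hE.partOrd).mp h₁
    obtain ⟨ψ, ψv, ψe⟩ := (mk_le_mk_iff hV.partOrd hE.partOrd).mp h₂
    refine le_trans ?_ (hM.2 ⟨φ.symm.trans ψ, rfl⟩)
    rw [size_mk, overlap, ← Equiv.sum_comp φ fun w => mcsSize leV sV {a w, _},
      ← Equiv.sum_comp (edgeEquiv φ) fun e => mcsSize leE sE {b e, _}]
    refine add_le_add (Finset.sum_le_sum fun w _ => ?_) (Finset.sum_le_sum fun e _ => ?_)
    · refine (hV.isGreatest_mcsSize _ _).2 ⟨α w, mem_commonSub_pair.mpr ⟨φv w, ?_⟩, rfl⟩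
      simpa using ψv w
    · refine (hE.isGreatest_mcsSize _ _).2 ⟨β e, mem_commonSub_pair.mpr ⟨φe e, ?_⟩, rfl⟩
      rw [edgeEquiv_trans_apply, edgeEquiv_symm, Equiv.symm_apply_apply]
      exact ψe e

end overlap

theorem isMCSModel (hV : IsMCSModel leV sV) (hE : IsMCSModel leE sE) :
    IsMCSModel (le (m := m) leV leE) (size sV sE) where
  partOrd := (isPartOrd_and_isSizeFunction hV hE).1
  size := (isPartOrd_and_isSizeFunction hV hE).2
  exists_max x y := by
    obtain ⟨W, _, hW, a, b, rfl⟩ := exists_eq_mk x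
    obtain ⟨W', _, hW', a', b', rfl⟩ := exists_eq_mk y
    classical
    have : Nonempty (W ≃ W') := ⟨Fintype.equivOfCardEq (hW.trans hW'.symm)⟩
    obtain ⟨f, hf⟩ := Finite.exists_max (overlap leV leE sV sE a b a' b')
    have h := isGreatest_size_commonSub (hW := hW) (hW' := hW') hV hE
      (M := overlap leV leE sV sE a b a' b' f) ⟨⟨f, rfl⟩, by rintro _ ⟨f', rfl⟩; exact hf f'⟩
    exact ⟨h.nonempty.of_image, _, h⟩
  diamond x₁ x₂ x h₁ h₂ := by
    classical
    obtain ⟨W₁, _, hW₁, a₁, b₁, rfl⟩ := exists_eq_mk x₁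
    obtain ⟨W₂, _, hW₂, a₂, b₂, rfl⟩ := exists_eq_mk x₂
    obtain ⟨W, _, hW, a, b, rfl⟩ := exists_eq_mk x
    obtain ⟨φ, φv, φe⟩ := (mk_le_mk_iff hV.partOrd hE.partOrd).mp h₁
    obtain ⟨ψ, ψv, ψe⟩ := (mk_le_mk_iff hV.partOrd hE.partOrd).mp h₂
    -- both graphs are transported to the vertex set of the common supergraph
    choose α hα hαs using fun w => hV.diamond (a₁ (φ.symm w)) (a₂ (ψ.symm w)) (a w)
      (by simpa using φv (φ.symm w)) (by simpa using ψv (ψ.symm w))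
    choose β hβ hβs using fun e => hE.diamond (b₁ ((edgeEquiv φ).symm e))
      (b₂ ((edgeEquiv ψ).symm e)) (b e)
      (by simpa using φe ((edgeEquiv φ).symm e)) (by simpa using ψe ((edgeEquiv ψ).symm e))
    refine ⟨mk W hW α β, mem_commonSub_pair.mpr ⟨?_, ?_⟩, ?_⟩
    · exact (mk_le_mk_iff hV.partOrd hE.partOrd).mpr
        ⟨φ.symm, fun w => (mem_commonSub_pair.mp (hα w)).1, fun e =>
          (mem_commonSub_pair.mp (hβ e)).1⟩
    · exact (mk_le_mk_iff hV.partOrd hE.partOrd).mpr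
        ⟨ψ.symm, fun w => (mem_commonSub_pair.mp (hα w)).2, fun e =>
          (mem_commonSub_pair.mp (hβ e)).2⟩
    · have s₁ := Finset.sum_le_sum fun w (_ : w ∈ Finset.univ) => hαs w
      have s₂ := Finset.sum_le_sum fun e (_ : e ∈ Finset.univ) => hβs e
      rw [Finset.sum_sub_distrib, Finset.sum_add_distrib] at s₁ s₂
      rw [Equiv.sum_comp φ.symm fun w => sV (a₁ w),
        Equiv.sum_comp ψ.symm fun w => sV (a₂ w)] at s₁
      rw [Equiv.sum_comp (edgeEquiv φ).symm fun e => sE (b₁ e),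
        Equiv.sum_comp (edgeEquiv ψ).symm fun e => sE (b₂ e)] at s₂
      simp only [size_mk]
      linarith

end completeGraphs

/-! ### The cost of a bijection between labelled complete graphs -/

section labelCost

variable {LV LV' : Type u} {LE LE' : Type v} {W W' : Type} [Fintype W]

open Classical in
/-- The cost of a bijection `f` between the vertices of two labelled complete graphs. -/
noncomputable def labelCost (cV : LV → LV → ℝ) (cE : LE → LE → ℝ) (a : W → LV)
    (b : (⊤ : SimpleGraph W).edgeSet → LE) (a' : W' → LV)
    (b' : (⊤ : SimpleGraph W').edgeSet → LE) (f : W ≃ W') : ℝ :=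
  ∑ w, cV (a w) (a' (f w)) + ∑ e, cE (b e) (b' (edgeEquiv f e))

theorem labelCost_eq_size_add_size_sub [Fintype W'] {m : ℕ} {cV : LV → LV → ℝ}
    {cE : LE → LE → ℝ} {ιV : LV → LV'} {ιE : LE → LE'} {leV : LV' → LV' → Prop} {sV : LV' → ℝ}
    {leE : LE' → LE' → Prop} {sE : LE' → ℝ}
    (hdV : ∀ a b, cV a b = sV (ιV a) + sV (ιV b) - 2 * mcsSize leV sV {ιV a, ιV b})
    (hdE : ∀ a b, cE a b = sE (ιE a) + sE (ιE b) - 2 * mcsSize leE sE {ιE a, ιE b})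
    (hW : Fintype.card W = m) (hW' : Fintype.card W' = m) (a : W → LV)
    (b : (⊤ : SimpleGraph W).edgeSet → LE) (a' : W' → LV)
    (b' : (⊤ : SimpleGraph W').edgeSet → LE) (f : W ≃ W') :
    labelCost cV cE a b a' b' f =
      completeGraphs.size sV sE
        (completeGraphs.mk W hW (fun w => ιV (a w)) fun e => ιE (b e)) +
      completeGraphs.size sV sE
        (completeGraphs.mk W' hW' (fun w => ιV (a' w)) fun e => ιE (b' e)) -
      2 * completeGraphs.overlap leV leE sV sE (fun w => ιV (a w)) (fun e => ιE (b e))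
        (fun w => ιV (a' w)) (fun e => ιE (b' e)) f := by
  classical
  rw [completeGraphs.size_mk, completeGraphs.size_mk, completeGraphs.overlap, labelCost,
    ← Equiv.sum_comp f fun w => sV (ιV (a' w)),
    ← Equiv.sum_comp (edgeEquiv f) fun e => sE (ιE (b' e))]
  simp only [hdV, hdE, Finset.sum_sub_distrib, Finset.sum_add_distrib, ← Finset.mul_sum]
  ring

end labelCost

/-! ### Completions and the graph edit distance -/

namespace LGraph

variable {SV : Type u} {SE : Type v}

/-- The vertex labels of the completion of `g` by a set `T` of new vertices. -/
def complVertexLabel (g : LGraph SV SE) (T : Type) : g.V ⊕ T → Option SV :=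
  Sum.elim (fun w => some (g.vlabel w)) fun _ => none

open Classical in
/-- The edge labels of the completion of `g` by a set `T` of new vertices. They are extended to
all unordered pairs: the diagonal pairs, which are not edges, also carry the empty label. -/
noncomputable def complEdgeLabel (g : LGraph SV SE) (T : Type) (e : Sym2 (g.V ⊕ T)) :
    Option SE :=
  if h : ∃ e₀ : g.graph.edgeSet, Sym2.map (Sum.inl : g.V → g.V ⊕ T) e₀.1 = e
    then some (g.elabel h.choose) else none

theorem card_sum_fin (g : LGraph SV SE) {m : ℕ} (h : g.order ≤ m) :
    Fintype.card (g.V ⊕ Fin (m - g.order)) = m :=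
  card_completion g h

theorem completion_elabel (g : LGraph SV SE) (m : ℕ)
    (e : (⊤ : SimpleGraph (g.V ⊕ Fin (m - g.order))).edgeSet) :
    (g.completion m).elabel e = g.complEdgeLabel _ e.1 := by
  unfold complEdgeLabel completion
  dsimp only
  congr

theorem complEdgeLabel_eq_some_iff {g : LGraph SV SE} {T : Type} {e : Sym2 (g.V ⊕ T)} {l : SE} :
    g.complEdgeLabel T e = some l ↔
      ∃ e₀ : g.graph.edgeSet, Sym2.map Sum.inl e₀.1 = e ∧ g.elabel e₀ = l := by
  unfold complEdgeLabel
  constructor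
  · intro h
    split_ifs at h with h'
    exact ⟨h'.choose, h'.choose_spec, Option.some.inj h⟩
  · rintro ⟨e₀, he, rfl⟩
    have h' : ∃ e₀ : g.graph.edgeSet, Sym2.map (Sum.inl : g.V → g.V ⊕ T) e₀.1 = e := ⟨e₀, he⟩
    rw [dif_pos h']
    congr 2
    exact Subtype.ext (Sym2.map.injective Sum.inl_injective (h'.choose_spec.trans he.symm))

theorem exists_of_complEdgeLabel_ne_none {g : LGraph SV SE} {T : Type} {e : Sym2 (g.V ⊕ T)}
    (h : g.complEdgeLabel T e ≠ none) :
    ∃ e₀ : g.graph.edgeSet, Sym2.map Sum.inl e₀.1 = e := by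
  obtain ⟨l, hl⟩ := Option.ne_none_iff_exists'.mp h
  obtain ⟨e₀, he, -⟩ := complEdgeLabel_eq_some_iff.mp hl
  exact ⟨e₀, he⟩

section transfer

variable {g : LGraph SV SE} {T T' : Type} {i : g.V ⊕ T → g.V ⊕ T'}

theorem complVertexLabel_map (hi : Function.Injective i) (hl : ∀ x, i (Sum.inl x) = Sum.inl x)
    (w : g.V ⊕ T) : g.complVertexLabel T' (i w) = g.complVertexLabel T w := by
  rcases w with x | t
  · rw [hl]
    rfl
  · rcases h : i (Sum.inr t) with x | t'
    · rw [← hl] at h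
      exact absurd (hi h) (by simp)
    · rfl

theorem complEdgeLabel_map (hi : Function.Injective i) (hl : ∀ x, i (Sum.inl x) = Sum.inl x)
    (e : Sym2 (g.V ⊕ T)) :
    g.complEdgeLabel T' (Sym2.map i e) = g.complEdgeLabel T e := by
  have key : ∀ e₀ : Sym2 g.V, Sym2.map i (Sym2.map Sum.inl e₀) = Sym2.map Sum.inl e₀ := by
    intro e₀
    rw [Sym2.map_map]
    exact congrFun (congrArg Sym2.map (funext hl)) e₀
  ext l
  rw [complEdgeLabel_eq_some_iff, complEdgeLabel_eq_some_iff]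
  refine exists_congr fun e₀ => and_congr_left fun _ => ?_
  rw [← key]
  exact (Sym2.map.injective hi).eq_iff

theorem complVertexLabel_eq_none (hl : ∀ x, i (Sum.inl x) = Sum.inl x) {w : g.V ⊕ T'}
    (hw : w ∉ Set.range i) : g.complVertexLabel T' w = none := by
  rcases w with x | t
  · exact absurd ⟨_, hl x⟩ hw
  · rfl

theorem complEdgeLabel_eq_none (hl : ∀ x, i (Sum.inl x) = Sum.inl x) {e : Sym2 (g.V ⊕ T')}
    (he : e ∉ Set.range (Sym2.map i)) : g.complEdgeLabel T' e = none := by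
  by_contra h
  obtain ⟨e₀, rfl⟩ := exists_of_complEdgeLabel_ne_none h
  refine he ⟨Sym2.map Sum.inl e₀.1, ?_⟩
  rw [Sym2.map_map]
  exact congrFun (congrArg Sym2.map (funext hl)) e₀.1

end transfer

section cost

variable {cV : Option SV → Option SV → ℝ} {cE : Option SE → Option SE → ℝ}
  {g₁ g₂ : LGraph SV SE} {T₁ T₂ T₁' T₂' : Type}
  [Fintype T₁] [Fintype T₁']

/-- The cost of a bijection between the vertices of two completions. -/
noncomputable def complCost (cV : Option SV → Option SV → ℝ) (cE : Option SE → Option SE → ℝ)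
    (g₁ g₂ : LGraph SV SE) (f : g₁.V ⊕ T₁ ≃ g₂.V ⊕ T₂) : ℝ :=
  labelCost cV cE (g₁.complVertexLabel T₁) (fun e => g₁.complEdgeLabel T₁ e.1)
    (g₂.complVertexLabel T₂) (fun e => g₂.complEdgeLabel T₂ e.1) f

theorem bijCost_eq_complCost {m : ℕ}
    (f : g₁.V ⊕ Fin (m - g₁.order) ≃ g₂.V ⊕ Fin (m - g₂.order)) :
    bijCost cV cE m g₁ g₂ f = complCost cV cE g₁ g₂ f := by
  unfold bijCost complCost labelCost
  refine congrArg₂ (· + ·) rfl ?_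
  -- the two sums also differ in the `Fintype` instance of the edge set
  refine @Finset.sum_bijective _ _ _ _ _ _ _ _ (id : _ → (⊤ : SimpleGraph _).edgeSet)
    Function.bijective_id (fun e => ?_) fun e _ => ?_
  · exact iff_of_true (@Finset.mem_univ _ (_) _) (@Finset.mem_univ _ (_) _)
  · exact congrArg₂ cE (completion_elabel g₁ m e) (completion_elabel g₂ m (edgeEquiv f e))

open Classical in
/-- The edge costs may be summed over all unordered pairs, since diagonal pairs contribute
nothing. -/
theorem complCost_eq_sum_sym2 (hE : cE none none = 0) (f : g₁.V ⊕ T₁ ≃ g₂.V ⊕ T₂) :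
    complCost cV cE g₁ g₂ f =
      ∑ w, cV (g₁.complVertexLabel T₁ w) (g₂.complVertexLabel T₂ (f w)) +
        ∑ e, cE (g₁.complEdgeLabel T₁ e) (g₂.complEdgeLabel T₂ (Sym2.map f e)) := by
  unfold complCost labelCost
  congr 1
  refine @Fintype.sum_of_injective _ _ _ (_) (_) _ Subtype.val Subtype.val_injective _ _
    (fun e he => ?_) fun e => rfl
  have hd : e.IsDiag := by
    by_contra h
    exact he ⟨⟨e, by simpa using h⟩, rfl⟩
  -- a diagonal pair carries the empty label, and so does its image
  have h₁ : g₁.complEdgeLabel _ e = none := by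
    by_contra h
    obtain ⟨e₀, rfl⟩ := exists_of_complEdgeLabel_ne_none h
    exact g₁.graph.not_isDiag_of_mem_edgeSet e₀.2
      ((Sym2.isDiag_map Sum.inl_injective).mp hd)
  have h₂ : g₂.complEdgeLabel _ (Sym2.map f e) = none := by
    by_contra h
    obtain ⟨e₀, he₀⟩ := exists_of_complEdgeLabel_ne_none h
    refine g₂.graph.not_isDiag_of_mem_edgeSet e₀.2
      ((Sym2.isDiag_map (β := g₂.V ⊕ T₂) Sum.inl_injective).mp ?_)
    rw [he₀]
    exact (Sym2.isDiag_map f.injective).mpr hd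
  rw [h₁, h₂, hE]

/-- Removing new vertices that are matched to new vertices does not change the cost. -/
theorem complCost_eq_of_comm (hV : cV none none = 0) (hE : cE none none = 0)
    {i₁ : g₁.V ⊕ T₁ → g₁.V ⊕ T₁'} {i₂ : g₂.V ⊕ T₂ → g₂.V ⊕ T₂'}
    (hi₁ : Function.Injective i₁) (hi₂ : Function.Injective i₂)
    (hl₁ : ∀ x, i₁ (Sum.inl x) = Sum.inl x) (hl₂ : ∀ x, i₂ (Sum.inl x) = Sum.inl x)
    (f : g₁.V ⊕ T₁ ≃ g₂.V ⊕ T₂) (F : g₁.V ⊕ T₁' ≃ g₂.V ⊕ T₂')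
    (hF : ∀ w, F (i₁ w) = i₂ (f w)) : complCost cV cE g₁ g₂ f = complCost cV cE g₁ g₂ F := by
  classical
  have hFe : ∀ e, Sym2.map F (Sym2.map i₁ e) = Sym2.map i₂ (Sym2.map f e) := by
    intro e
    rw [Sym2.map_map, Sym2.map_map]
    exact congrFun (congrArg Sym2.map (funext hF)) e
  rw [complCost_eq_sum_sym2 hE, complCost_eq_sum_sym2 hE]
  congr 1
  · refine Fintype.sum_of_injective i₁ hi₁ _ _ (fun w hw => ?_) fun w => ?_
    · rw [complVertexLabel_eq_none hl₁ hw, complVertexLabel_eq_none hl₂, hV]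
      rintro ⟨w', hw'⟩
      refine hw ⟨f.symm w', F.injective ?_⟩
      rw [hF, Equiv.apply_symm_apply, hw']
    · rw [hF, complVertexLabel_map hi₁ hl₁, complVertexLabel_map hi₂ hl₂]
  · refine Fintype.sum_of_injective (Sym2.map i₁) (Sym2.map.injective hi₁) _ _
      (fun e he => ?_) fun e => ?_
    · rw [complEdgeLabel_eq_none hl₁ he, complEdgeLabel_eq_none hl₂, hE]
      rintro ⟨e', he'⟩
      refine he ⟨Sym2.map f.symm e', Sym2.map.injective F.injective ?_⟩
      rw [hFe, Sym2.map_map (g := f), Equiv.self_comp_symm, Sym2.map_id, id, he']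
    · rw [hFe, complEdgeLabel_map hi₁ hl₁, complEdgeLabel_map hi₂ hl₂]

end cost

end LGraph

/-- A bijection between two sums extends to a bijection after summands are enlarged. -/
theorem exists_equiv_extending {V₁ V₂ T₁ T₂ T₁' T₂' : Type} [Fintype V₁] [Fintype V₂]
    [Fintype T₁] [Fintype T₂] [Fintype T₁'] [Fintype T₂']
    (h₁ : Fintype.card T₁ ≤ Fintype.card T₁') (h₂ : Fintype.card T₂ ≤ Fintype.card T₂')
    (h : Fintype.card (V₁ ⊕ T₁') = Fintype.card (V₂ ⊕ T₂')) (f : V₁ ⊕ T₁ ≃ V₂ ⊕ T₂) :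
    ∃ (i₁ : V₁ ⊕ T₁ → V₁ ⊕ T₁') (i₂ : V₂ ⊕ T₂ → V₂ ⊕ T₂') (F : V₁ ⊕ T₁' ≃ V₂ ⊕ T₂'),
      Function.Injective i₁ ∧ Function.Injective i₂ ∧ (∀ x, i₁ (Sum.inl x) = Sum.inl x) ∧
      (∀ x, i₂ (Sum.inl x) = Sum.inl x) ∧ ∀ w, F (i₁ w) = i₂ (f w) := by
  classical
  obtain ⟨j₁⟩ := Function.Embedding.nonempty_of_card_le h₁
  obtain ⟨j₂⟩ := Function.Embedding.nonempty_of_card_le h₂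
  have hi₁ : Function.Injective (Sum.map id j₁ : V₁ ⊕ T₁ → V₁ ⊕ T₁') :=
    Function.injective_id.sumMap j₁.injective
  have hi₂ : Function.Injective (Sum.map id j₂ : V₂ ⊕ T₂ → V₂ ⊕ T₂') :=
    Function.injective_id.sumMap j₂.injective
  obtain ⟨F₀⟩ : Nonempty (V₁ ⊕ T₁' ≃ V₂ ⊕ T₂') := ⟨Fintype.equivOfCardEq h⟩
  have hext : Set.InjOn
      (Function.extend (Sum.map id j₁) (fun w => (Sum.map id j₂ (f w) : V₂ ⊕ T₂')) F₀)
      (Set.range (Sum.map id j₁ : V₁ ⊕ T₁ → V₁ ⊕ T₁')) := by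
    rintro _ ⟨x, rfl⟩ _ ⟨y, rfl⟩ hxy
    rw [hi₁.extend_apply, hi₁.extend_apply] at hxy
    rw [f.injective (hi₂ hxy)]
  obtain ⟨F, hF⟩ := Set.MapsTo.exists_equiv_extend_of_card_eq
    (t := (Finset.univ : Finset (V₂ ⊕ T₂'))) (h.trans Finset.card_univ.symm)
    (fun _ _ => Finset.mem_coe.mpr (Finset.mem_univ _)) hext
  refine ⟨Sum.map id j₁, Sum.map id j₂, F.trans (Equiv.subtypeUnivEquiv Finset.mem_univ), hi₁, hi₂,
    fun _ => rfl, fun _ => rfl, fun w => ?_⟩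
  exact (hF _ ⟨w, rfl⟩).trans (hi₁.extend_apply _ _ _)

/-- A bijection between large sums restricts to a bijection of given smaller sums, if these have
room for `V₁`, `V₂` and all of their partners. -/
theorem exists_equiv_restricting {V₁ V₂ T₁ T₂ T₁' T₂' : Type} [Fintype V₁] [Fintype V₂]
    [Fintype T₁] [Fintype T₂] [Fintype T₁'] [Fintype T₂']
    (h₁ : Fintype.card T₁ ≤ Fintype.card T₁')
    (h : Fintype.card (V₁ ⊕ T₁) = Fintype.card (V₂ ⊕ T₂))
    (hV : Fintype.card V₁ + Fintype.card V₂ ≤ Fintype.card (V₁ ⊕ T₁))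
    (F : V₁ ⊕ T₁' ≃ V₂ ⊕ T₂') :
    ∃ (i₁ : V₁ ⊕ T₁ → V₁ ⊕ T₁') (i₂ : V₂ ⊕ T₂ → V₂ ⊕ T₂') (f : V₁ ⊕ T₁ ≃ V₂ ⊕ T₂),
      Function.Injective i₁ ∧ Function.Injective i₂ ∧ (∀ x, i₁ (Sum.inl x) = Sum.inl x) ∧
      (∀ x, i₂ (Sum.inl x) = Sum.inl x) ∧ ∀ w, F (i₁ w) = i₂ (f w) := by
  classical
  obtain ⟨S, hS, hcard⟩ := Finset.exists_superset_card_eq (n := Fintype.card (V₁ ⊕ T₁))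
    (s := Finset.univ.image (Sum.inl : V₁ → V₁ ⊕ T₁') ∪
      Finset.univ.image fun y : V₂ => F.symm (Sum.inl y))
    ((Finset.card_union_le _ _).trans
      ((add_le_add Finset.card_image_le Finset.card_image_le).trans hV))
    (by simpa using h₁)
  -- an enumeration of a set containing all of `V` that starts with `V`
  have enum : ∀ {V T T' : Type} [Fintype V] [Fintype T] (R : Finset (V ⊕ T')),
      (∀ x, Sum.inl x ∈ R) → Fintype.card (V ⊕ T) = R.card →
      ∃ i : V ⊕ T ≃ R, ∀ x, (i (Sum.inl x)).1 = Sum.inl x := by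
    intro V T T' _ _ R hR hc
    rcases isEmpty_or_nonempty V with hV | ⟨⟨x₀⟩⟩
    · exact ⟨Fintype.equivOfCardEq (by simpa using hc), fun x => hV.elim x⟩
    obtain ⟨i, hi⟩ := Set.MapsTo.exists_equiv_extend_of_card_eq hc
      (s := Set.range Sum.inl) (f := Sum.elim Sum.inl fun _ => Sum.inl x₀)
      (by rintro _ ⟨x, rfl⟩; exact hR x)
      (by rintro _ ⟨x, rfl⟩ _ ⟨y, rfl⟩ hxy; simpa using hxy)
    exact ⟨i, fun x => hi _ ⟨x, rfl⟩⟩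
  obtain ⟨i₁, hi₁⟩ := enum (T := T₁) S
    (fun x => hS (Finset.mem_union_left _ (Finset.mem_image_of_mem _ (Finset.mem_univ x))))
    hcard.symm
  obtain ⟨i₂, hi₂⟩ := enum (T := T₂) (S.map F.toEmbedding)
    (fun y => Finset.mem_map_equiv.mpr
      (hS (Finset.mem_union_right _ (Finset.mem_image.mpr ⟨y, Finset.mem_univ y, rfl⟩))))
    (by rw [Finset.card_map, hcard, h])
  have hF : ∀ w, w ∈ S ↔ F w ∈ S.map F.toEmbedding := fun w => by simp
  refine ⟨fun w => i₁ w, fun w => i₂ w, (i₁.trans (F.subtypeEquiv hF)).trans i₂.symm,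
    Subtype.val_injective.comp i₁.injective, Subtype.val_injective.comp i₂.injective,
    hi₁, hi₂, fun w => ?_⟩
  simp

namespace LGraph

variable {SV : Type u} {SE : Type v} {cV : Option SV → Option SV → ℝ}
  {cE : Option SE → Option SE → ℝ}

/-- Completions larger than those in the definition of the graph edit distance lead to the same
costs. -/
theorem isLeast_complCost (hV : cV none none = 0) (hE : cE none none = 0) (g₁ g₂ : LGraph SV SE)
    {m : ℕ} (hm : g₁.order + g₂.order ≤ m) :
    IsLeast (Set.range fun f : g₁.V ⊕ Fin (m - g₁.order) ≃ g₂.V ⊕ Fin (m - g₂.order) =>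
      complCost cV cE g₁ g₂ f) (ged cV cE g₁ g₂) := by
  have hcard : ∀ k, g₁.order + g₂.order ≤ k →
      Fintype.card (g₁.V ⊕ Fin (k - g₁.order)) = k ∧
      Fintype.card (g₂.V ⊕ Fin (k - g₂.order)) = k := fun k hk =>
    ⟨card_sum_fin g₁ ((Nat.le_add_right _ _).trans hk),
      card_sum_fin g₂ ((Nat.le_add_left _ _).trans hk)⟩
  have h₁ := hcard _ le_rfl
  have h₂ := hcard m hm
  convert isLeast_ged cV cE g₁ g₂ using 1
  apply Set.Subset.antisymm
  · rintro _ ⟨F, rfl⟩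
    obtain ⟨i₁, i₂, f, hi₁, hi₂, hl₁, hl₂, hf⟩ := exists_equiv_restricting
      (T₁ := Fin (g₁.order + g₂.order - g₁.order)) (T₂ := Fin (g₁.order + g₂.order - g₂.order))
      (by simpa using Nat.sub_le_sub_right hm g₁.order) (h₁.1.trans h₁.2.symm) (h₁.1.ge) F
    exact ⟨f, (bijCost_eq_complCost f).trans (complCost_eq_of_comm hV hE hi₁ hi₂ hl₁ hl₂ f F hf)⟩
  · rintro _ ⟨f, rfl⟩
    obtain ⟨i₁, i₂, F, hi₁, hi₂, hl₁, hl₂, hf⟩ := exists_equiv_extending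
      (T₁' := Fin (m - g₁.order)) (T₂' := Fin (m - g₂.order))
      (by simpa using Nat.sub_le_sub_right hm g₁.order)
      (by simpa using Nat.sub_le_sub_right hm g₂.order) (h₂.1.trans h₂.2.symm) f
    exact ⟨F, (complCost_eq_of_comm hV hE hi₁ hi₂ hl₁ hl₂ f F hf).symm.trans
      (bijCost_eq_complCost f).symm⟩

end LGraph

/-! ### The completion as an embedding -/

section embedding

variable {SV LV : Type u} {SE LE : Type v} {m : ℕ}

/-- The class of the completion of `g` to `m` vertices, relabelled by `ιV` and `ιE`. -/
noncomputable def completionClass (ιV : Option SV → LV) (ιE : Option SE → LE)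
    (g : LGraph SV SE) (h : g.order ≤ m) : completeGraphs LV LE m :=
  completeGraphs.mk (g.V ⊕ Fin (m - g.order)) (LGraph.card_sum_fin g h)
    (fun w => ιV (g.complVertexLabel _ w)) fun e => ιE (g.complEdgeLabel _ e.1)

variable {ιV : Option SV → LV} {ιE : Option SE → LE}

theorem coe_completionClass (g : LGraph SV SE) (h : g.order ≤ m) :
    (completionClass ιV ιE g h).1 = ⟦(g.completion m).relabel ιV ιE⟧ :=
  congrArg (fun b => (⟦LGraph.ofLabels (g.V ⊕ Fin (m - g.order))
      (fun w => ιV (g.complVertexLabel _ w)) b⟧ : GraphClass LV LE))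
    (funext fun e => congrArg ιE (LGraph.completion_elabel g m e).symm)

theorem completionClass_eq_of_isomorphic {g h : LGraph SV SE} (hg : g.order ≤ m)
    (hh : h.order ≤ m) (i : g.Isomorphic h) :
    completionClass ιV ιE g hg = completionClass ιV ιE h hh := by
  have ho := i.order_eq
  obtain ⟨φ, hv, he⟩ := i
  refine completeGraphs.mk_eq_mk_iff.mpr
    ⟨Equiv.sumCongr φ.toEquiv (finCongr (by rw [ho])), fun w => congrArg ιV ?_,
      fun e => congrArg ιE ?_⟩
  · rcases w with x | t
    · exact congrArg some (hv x)
    · rfl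
  · ext l
    rw [LGraph.complEdgeLabel_eq_some_iff, LGraph.complEdgeLabel_eq_some_iff, coe_edgeEquiv]
    refine φ.mapEdgeSet.exists_congr fun e₀ => ?_
    rw [he]
    refine and_congr_left fun _ => ?_
    have key : Sym2.map (Sum.inl : h.V → h.V ⊕ Fin (m - h.order)) (φ.mapEdgeSet e₀).1 =
        Sym2.map (Equiv.sumCongr φ.toEquiv (finCongr (by rw [ho])))
          (Sym2.map (Sum.inl : g.V → g.V ⊕ Fin (m - g.order)) e₀.1) := by
      obtain ⟨e₀, h₀⟩ := e₀
      induction e₀ with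
      | _ a b => rfl
    rw [key]
    exact (Sym2.map.injective (Equiv.injective _)).eq_iff.symm

/-- A graph is determined by its completion: the nonempty labels mark its vertices and edges. -/
theorem isomorphic_of_completionClass_eq (hιV : Function.Injective ιV)
    (hιE : Function.Injective ιE) {g h : LGraph SV SE} {hg : g.order ≤ m} {hh : h.order ≤ m}
    (H : completionClass ιV ιE g hg = completionClass ιV ιE h hh) : g.Isomorphic h := by
  obtain ⟨f, hv, he⟩ := completeGraphs.mk_eq_mk_iff.mp H
  have hv : ∀ w, g.complVertexLabel _ w = h.complVertexLabel _ (f w) := fun w => hιV (hv w)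
  have he : ∀ e, ¬ e.IsDiag →
      g.complEdgeLabel _ e = h.complEdgeLabel _ (Sym2.map f e) := fun e hd =>
    hιE (he ⟨e, by simpa using hd⟩)
  have h₁ : ∀ x, ∃ y, f (Sum.inl x) = Sum.inl y := by
    intro x
    have hx := hv (Sum.inl x)
    rcases hy : f (Sum.inl x) with y | t
    · exact ⟨y, rfl⟩
    · rw [hy] at hx
      cases hx
  have h₂ : ∀ y, ∃ x, f.symm (Sum.inl y) = Sum.inl x := by
    intro y
    have hx := hv (f.symm (Sum.inl y))
    rw [Equiv.apply_symm_apply] at hx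
    rcases hy : f.symm (Sum.inl y) with x | t
    · exact ⟨x, rfl⟩
    · rw [hy] at hx
      cases hx
  choose φ hφ using h₁
  choose ψ hψ using h₂
  let σ : g.V ≃ h.V :=
    { toFun := φ
      invFun := ψ
      left_inv := fun x => Sum.inl_injective (β := Fin (m - g.order))
        (by rw [← hψ, ← hφ, Equiv.symm_apply_apply])
      right_inv := fun y => Sum.inl_injective (β := Fin (m - h.order))
        (by rw [← hφ, ← hψ, Equiv.apply_symm_apply]) }
  have hmap : ∀ e : Sym2 g.V, Sym2.map f (Sym2.map Sum.inl e) =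
      Sym2.map (Sum.inl : h.V → h.V ⊕ Fin (m - h.order)) (Sym2.map σ e) := by
    intro e
    rw [Sym2.map_map, Sym2.map_map]
    exact congrFun (congrArg Sym2.map (funext hφ)) e
  have hlab : ∀ (e : Sym2 g.V) (l : SE), ¬ e.IsDiag →
      ((∃ e₀ : g.graph.edgeSet, e₀.1 = e ∧ g.elabel e₀ = l) ↔
        ∃ e₀ : h.graph.edgeSet, e₀.1 = Sym2.map σ e ∧ h.elabel e₀ = l) := by
    intro e l hd
    have key := he (Sym2.map Sum.inl e) (by rwa [Sym2.isDiag_map Sum.inl_injective])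
    rw [hmap] at key
    have key := (congrArg (· = some l) key).to_iff
    rw [LGraph.complEdgeLabel_eq_some_iff, LGraph.complEdgeLabel_eq_some_iff] at key
    simpa only [(Sym2.map.injective Sum.inl_injective).eq_iff] using key
  have hadj : ∀ {a b : g.V}, h.graph.Adj (σ a) (σ b) ↔ g.graph.Adj a b := by
    intro a b
    rcases eq_or_ne a b with rfl | hab
    · simp
    · constructor
      · intro hs
        obtain ⟨e₀, h₀, -⟩ := (hlab s(a, b) (h.elabel ⟨s(σ a, σ b), hs⟩) (by simpa using hab)).mpr
          ⟨_, rfl, rfl⟩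
        exact (SimpleGraph.mem_edgeSet _).mp (h₀ ▸ e₀.2)
      · intro hs
        obtain ⟨e₀, h₀, -⟩ := (hlab s(a, b) (g.elabel ⟨s(a, b), hs⟩) (by simpa using hab)).mp
          ⟨_, rfl, rfl⟩
        exact (SimpleGraph.mem_edgeSet _).mp (by simpa [h₀] using e₀.2)
  refine ⟨⟨σ, hadj⟩, fun w => ?_, fun e => ?_⟩
  · have hw := hv (Sum.inl w)
    rw [hφ] at hw
    exact Option.some.inj hw
  · obtain ⟨e₀, h₀, hl⟩ := (hlab e.1 (g.elabel e)
      (g.graph.not_isDiag_of_mem_edgeSet e.2)).mp ⟨e, rfl, rfl⟩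
    rw [← hl]
    congr 1
    exact Subtype.ext h₀

/-- If the label models realise the edit costs, then their total size on completions realises
the graph edit distance: for each bijection of the completions, the sizes of the two graphs minus
twice its overlap is its cost, so the largest overlap belongs to the cheapest bijection. -/
theorem ged_eq_size_add_size_sub {leV : LV → LV → Prop} {sV : LV → ℝ} {leE : LE → LE → Prop}
    {sE : LE → ℝ} {cV : Option SV → Option SV → ℝ} {cE : Option SE → Option SE → ℝ}
    (hV : IsMCSModel leV sV) (hE : IsMCSModel leE sE) (hcV : IsMetric cV) (hcE : IsMetric cE)
    (hdV : ∀ a b, cV a b = sV (ιV a) + sV (ιV b) - 2 * mcsSize leV sV {ιV a, ιV b})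
    (hdE : ∀ a b, cE a b = sE (ιE a) + sE (ιE b) - 2 * mcsSize leE sE {ιE a, ιE b})
    (g₁ g₂ : LGraph SV SE) (hm : g₁.order + g₂.order ≤ m) (h₁ : g₁.order ≤ m)
    (h₂ : g₂.order ≤ m) :
    LGraph.ged cV cE g₁ g₂ = completeGraphs.size sV sE (completionClass ιV ιE g₁ h₁) +
      completeGraphs.size sV sE (completionClass ιV ιE g₂ h₂) -
      2 * mcsSize (completeGraphs.le leV leE) (completeGraphs.size sV sE)
        {completionClass ιV ιE g₁ h₁, completionClass ιV ιE g₂ h₂} := by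
  have hleast := LGraph.isLeast_complCost (hcV.self none) (hcE.self none) g₁ g₂ hm
  have hcost : ∀ f : g₁.V ⊕ Fin (m - g₁.order) ≃ g₂.V ⊕ Fin (m - g₂.order),
      LGraph.complCost cV cE g₁ g₂ f =
      completeGraphs.size sV sE (completionClass ιV ιE g₁ h₁) +
      completeGraphs.size sV sE (completionClass ιV ιE g₂ h₂) -
      2 * completeGraphs.overlap leV leE sV sE
        (fun w => ιV (g₁.complVertexLabel _ w)) (fun e => ιE (g₁.complEdgeLabel _ e.1))
        (fun w => ιV (g₂.complVertexLabel _ w)) (fun e => ιE (g₂.complEdgeLabel _ e.1))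
        f :=
    labelCost_eq_size_add_size_sub hdV hdE (LGraph.card_sum_fin g₁ h₁)
      (LGraph.card_sum_fin g₂ h₂) _ _ _ _
  obtain ⟨f, hf⟩ := hleast.1
  have hgreat := completeGraphs.isGreatest_size_commonSub
    (hW := LGraph.card_sum_fin g₁ h₁) (hW' := LGraph.card_sum_fin g₂ h₂) hV hE
    (a := fun w => ιV (g₁.complVertexLabel _ w))
    (b := fun e => ιE (g₁.complEdgeLabel _ e.1))
    (a' := fun w => ιV (g₂.complVertexLabel _ w))
    (b' := fun e => ιE (g₂.complEdgeLabel _ e.1)) (M := _) ⟨⟨f, rfl⟩, by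
      rintro _ ⟨f', rfl⟩
      have := hleast.2 ⟨f', rfl⟩
      dsimp only at hf this
      rw [← hf, hcost, hcost] at this
      linarith⟩
  dsimp only at hf
  rw [← hf, hcost, mcsSize]
  congr 2
  exact hgreat.csSup_eq.symm

end embedding

end GEDMCS

theorem mainTheorem2 {SV : Type u} {SE : Type v} [Finite SV] [Finite SE] (n : ℕ)
    (cV : Option SV → Option SV → ℝ) (cE : Option SE → Option SE → ℝ)
    (hV : IsMetric cV) (hE : IsMetric cE) :
    ∃ (LV : Type u) (LE : Type v) (ιV : Option SV → LV) (ιE : Option SE → LE)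
      (leV : LV → LV → Prop) (sV : LV → ℝ) (leE : LE → LE → Prop) (sE : LE → ℝ),
      -- label models
      Function.Injective ιV ∧ Function.Injective ιE ∧
      IsMCSModel leV sV ∧ (∀ a, 0 < sV a) ∧ IsMCSModel leE sE ∧ (∀ b, 0 < sE b) ∧
      ∃ (le : completeGraphs LV LE (2 * n) → completeGraphs LV LE (2 * n) → Prop)
        (s : completeGraphs LV LE (2 * n) → ℝ)
        (θ : smallGraphs SV SE n → completeGraphs LV LE (2 * n)),
        -- the order is the extended subgraph relation and the size is the total label size
        (∀ (x y : completeGraphs LV LE (2 * n)) (g h : LGraph LV LE),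
          ⟦g⟧ = x.1 → ⟦h⟧ = y.1 → (le x y ↔ g.ExtSub leV leE h)) ∧
        (∀ (x : completeGraphs LV LE (2 * n)) (g : LGraph LV LE),
          ⟦g⟧ = x.1 → s x = g.totalSize sV sE) ∧
        -- the map is the graph completion
        (∀ (x : smallGraphs SV SE n) (g : LGraph SV SE),
          ⟦g⟧ = x.1 → (θ x).1 = ⟦(g.completion (2 * n)).relabel ιV ιE⟧) ∧
        IsMCSModel le s ∧ Function.Injective θ ∧
        ∀ (x₁ x₂ : smallGraphs SV SE n) (g₁ g₂ : LGraph SV SE), ⟦g₁⟧ = x₁.1 → ⟦g₂⟧ = x₂.1 →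
          LGraph.ged cV cE g₁ g₂ = s (θ x₁) + s (θ x₂) - 2 * mcsSize le s {θ x₁, θ x₂} := by
  obtain ⟨LV, ιV, leV, sV, hιV, hmV, hposV, hdV⟩ := exists_isMCSModel_of_isMetric hV
  obtain ⟨LE, ιE, leE, sE, hιE, hmE, hposE, hdE⟩ := exists_isMCSModel_of_isMetric hE
  have horder : ∀ x : smallGraphs SV SE n, x.2.choose.order ≤ 2 * n := fun x =>
    x.2.choose_spec.2.trans (Nat.le_mul_of_pos_left n two_pos)
  have hrep : ∀ (x : smallGraphs SV SE n) (g : LGraph SV SE), ⟦g⟧ = x.1 →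
      x.2.choose.Isomorphic g := fun x g hg =>
    Quotient.exact (x.2.choose_spec.1.trans hg.symm)
  have hn : ∀ (x : smallGraphs SV SE n) (g : LGraph SV SE), ⟦g⟧ = x.1 → g.order ≤ n :=
    fun x g hg => (hrep x g hg).order_eq ▸ x.2.choose_spec.2
  have hθ : ∀ (x : smallGraphs SV SE n) (g : LGraph SV SE) (hg : ⟦g⟧ = x.1)
      (ho : g.order ≤ 2 * n),
      completionClass ιV ιE x.2.choose (horder x) = completionClass ιV ιE g ho :=
    fun x g hg ho => completionClass_eq_of_isomorphic _ _ (hrep x g hg)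
  refine ⟨LV, LE, ιV, ιE, leV, sV, leE, sE, hιV, hιE, hmV, hposV, hmE, hposE,
    completeGraphs.le leV leE, completeGraphs.size sV sE,
    fun x => completionClass ιV ιE x.2.choose (horder x),
    fun x y g h hg hh => completeGraphs.le_iff hmV.partOrd hmE.partOrd hg hh,
    fun x g hg => completeGraphs.size_eq sV sE hg, fun x g hg => ?_,
    completeGraphs.isMCSModel hmV hmE, fun x y hxy => ?_, fun x₁ x₂ g₁ g₂ hg₁ hg₂ => ?_⟩
  · have ho : g.order ≤ 2 * n := (hn x g hg).trans (Nat.le_mul_of_pos_left n two_pos)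
    exact (congrArg Subtype.val (hθ x g hg ho)).trans (coe_completionClass g ho)
  · have hi := isomorphic_of_completionClass_eq hιV hιE hxy
    exact Subtype.ext (x.2.choose_spec.1.symm.trans
      ((Quotient.sound (s := LGraph.setoid SV SE) hi).trans y.2.choose_spec.1))
  · have h₁ := hn x₁ g₁ hg₁
    have h₂ := hn x₂ g₂ hg₂
    have ho₁ : g₁.order ≤ 2 * n := by lia
    have ho₂ : g₂.order ≤ 2 * n := by lia
    dsimp only
    rw [hθ x₁ g₁ hg₁ ho₁, hθ x₂ g₂ hg₂ ho₂]
    exact ged_eq_size_add_size_sub hmV hmE hV hE hdV hdE g₁ g₂ (by lia) ho₁ ho₂
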